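/- A \emph{network} $(G,r)$ is an undirected multigraph $G$ with a function $r:E(G)\to\mathbb{R}_{>0}$ (resistances); it is connected, respectively locally finite, if $G$ is. A \emph{subnetwork} is a subgraph with the restricted resistance function. A directed edge is a triple $\vec e=(e,x,y)$ where $e$ is an edge with ends $x\neq y$; it points from $x$ to $y$. A function $f$ on the directed edges is \emph{antisymmetric} if $f(e,x,y)=-f(e,y,x)$; its \emph{energy} is $\sum_{e} r(e)f(\vec e)^2$, the sum being over the non-loop edges $e$, and its \emph{accumulation} at a vertex $v$ is the sum of $f(\vec e)$ over all directed edges $\vec e$ pointing to $v$. A \emph{$v$-flow of intensity $I$} is an antisymmetric function with accumulation $I$ at $v$ and accumulation $0$ at every other vertex. A network is \emph{transient} if for some vertex $v$ it has a $v$-flow of non-zero intensity with finite energy. A \emph{potential} on a network is a real-valued function $h$ on its vertices; its energy is $\sum_{e=xy}(h(x)-h(y))^2/r(e)$. It is \emph{harmonic} if for every vertex $v$ that has a neighbour $$h(v)=\Bigl(\sum_{e=vw}\tfrac1{r(e)}\Bigr)^{-1}\sum_{e=vw}\tfrac{h(w)}{r(e)},$$ where the sums are over the edges $e$ from $v$ to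 other vertices $w$. A network is in $\mathcal{O}_{HD}$ if every harmonic function of finite energy on it is constant. For vertex-disjoint subnetworks $A,B$ of $(G,r)$, let $G/A/B$ be the network obtained from $G$ by identifying all vertices of $A$ to one vertex (again denoted $A$) and all vertices of $B$ to one vertex (again denoted $B$); all edges keep their resistances, and edges whose ends become identified are regarded as loops. \textbf{Theorem.} A connected locally finite network $(G,r)$ is not in $\mathcal{O}_{HD}$ if and only if there are transient vertex-disjoint subnetworks $A$ and $B$ of $(G,r)$ such that $G/A/B$ admits a potential $\rho$ of finite energy with $\rho(A)\neq\rho(B)$. -/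

import Mathlib

open scoped Graph ENNReal

/-!
A network is a multigraph `G : Graph α β` (parallel edges and loops allowed) together with a
resistance function `r : β → ℝ` that is positive on the edge set `E(G)`. A subnetwork is a
subgraph `A ≤ G` with the restricted resistance function, which is again called `r`.
Functions on vertices, edges or directed edges are total functions on the ambient types; only
their values on `V(G)`, `E(G)` and `Network.dirEdges G` matter.
-/

namespace Network

variable {α β : Type*}

/-- A multigraph is connected if it is nonempty and any two vertices are joined by a walk. -/
def IsConnected (G : Graph α β) : Prop :=
  V(G).Nonempty ∧ ∀ x ∈ V(G), ∀ y ∈ V(G), Relation.ReflTransGen G.Adj x y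

/-- A multigraph is locally finite if every vertex is incident with only finitely many edges. -/
def IsLocallyFinite (G : Graph α β) : Prop :=
  ∀ v ∈ V(G), {e | G.Inc e v}.Finite

/-- The directed edges of `G`: triples `(e, x, y)` where `e` is an edge with the distinct
ends `x` (initial vertex) and `y` (terminal vertex). -/
def dirEdges (G : Graph α β) : Set (β × α × α) :=
  {d | G.IsLink d.1 d.2.1 d.2.2 ∧ d.2.1 ≠ d.2.2}

/-- The directed edges with initial vertex `v`. -/
def outEdges (G : Graph α β) (v : α) : Set (β × α × α) :=
  {d | d ∈ dirEdges G ∧ d.2.1 = v}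

/-- The directed edges with terminal vertex `v`. -/
def inEdges (G : Graph α β) (v : α) : Set (β × α × α) :=
  {d | d ∈ dirEdges G ∧ d.2.2 = v}

/-- `φ` is antisymmetric on the directed edges of `G`. -/
def IsAntisymm (G : Graph α β) (φ : β × α × α → ℝ) : Prop :=
  ∀ e x y, (e, x, y) ∈ dirEdges G → φ (e, x, y) = -φ (e, y, x)

/-- The energy `∑_{e ∈ E(G)} r(e) φ(e)²` of an antisymmetric function `φ` on the directed edges.
The sum runs over the directed edges, where each non-loop edge occurs in both of its
orientations, with the same value of `φ²`; hence the factor `1/2`. -/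
noncomputable def energy (G : Graph α β) (r : β → ℝ) (φ : β × α × α → ℝ) : ℝ≥0∞ :=
  (∑' d : dirEdges G, ENNReal.ofReal (r d.1.1 * φ d.1 ^ 2)) / 2

/-- The function on directed edges induced by a potential `ρ`:
`(e, x, y) ↦ (ρ(x) - ρ(y)) / r(e)`. -/
noncomputable def induced (r : β → ℝ) (ρ : α → ℝ) : β × α × α → ℝ :=
  fun d => (ρ d.2.1 - ρ d.2.2) / r d.1

/-- A potential has finite energy if the function that it induces on directed edges has. -/
def PotentialFiniteEnergy (G : Graph α β) (r : β → ℝ) (ρ : α → ℝ) : Prop :=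
  energy G r (induced r ρ) < ⊤

/-- A potential `h` on a locally finite network is harmonic if at every vertex `v` its value is
the mean of its values at the neighbours of `v`, weighted with the conductances `1 / r(e)`.
A vertex without neighbours imposes no condition. (A loop at `v` does not affect the mean value
property at `v`.) -/
def IsHarmonic (G : Graph α β) (r : β → ℝ) (h : α → ℝ) : Prop :=
  ∀ v ∈ V(G), (outEdges G v).Nonempty →
    h v = (∑ᶠ d ∈ outEdges G v, 1 / r d.1)⁻¹ * ∑ᶠ d ∈ outEdges G v, h d.2.2 * (1 / r d.1)

/-- The class `O_HD`: every harmonic function of finite energy is constant. -/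
def InOHD (G : Graph α β) (r : β → ℝ) : Prop :=
  ∀ h : α → ℝ, IsHarmonic G r h → PotentialFiniteEnergy G r h →
    ∀ x ∈ V(G), ∀ y ∈ V(G), h x = h y

/-- The accumulation of `φ` at the vertex `v` (a finite sum if `G` is locally finite). -/
noncomputable def accumulation (G : Graph α β) (φ : β × α × α → ℝ) (v : α) : ℝ :=
  ∑ᶠ d ∈ inEdges G v, φ d

/-- `φ` is a `v`-flow of intensity `I` in `G`: it is antisymmetric, has accumulation `I` at `v`,
and satisfies Kirchhoff's node law at every other vertex. -/
def IsFlow (G : Graph α β) (v : α) (I : ℝ) (φ : β × α × α → ℝ) : Prop :=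
  IsAntisymm G φ ∧ accumulation G φ v = I ∧ ∀ w ∈ V(G), w ≠ v → accumulation G φ w = 0

/-- A network is transient if for some vertex `v` there is a `v`-flow of non-zero intensity
with finite energy. -/
def IsTransient (G : Graph α β) (r : β → ℝ) : Prop :=
  ∃ v ∈ V(G), ∃ I : ℝ, I ≠ 0 ∧ ∃ φ : β × α × α → ℝ, IsFlow G v I φ ∧ energy G r φ < ⊤

/-- Vertices of `G/A/B`: the two contraction vertices `A` and `B`, and the old vertices of `G`
outside `A` and `B`. -/
inductive ContractVertex (α : Type*)
  | vertexA : ContractVertex α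
  | vertexB : ContractVertex α
  | old (v : α) : ContractVertex α

open Classical in
/-- The map sending each vertex of `G` to the corresponding vertex of `G/A/B`. -/
noncomputable def contractMap (A B : Graph α β) (v : α) : ContractVertex α :=
  if v ∈ V(A) then .vertexA else if v ∈ V(B) then .vertexB else .old v

/-- The contraction `G/A/B` of each of the vertex-disjoint subgraphs `A` and `B` of `G` to a
vertex. Every edge of `G` remains an edge, with the same resistance, and its ends are the images
of the old ends; in particular edges with both ends in `A`, or both in `B`, become loops, which
do not contribute to the energy of a potential. -/
noncomputable def contraction (G A B : Graph α β) : Graph (ContractVertex α) β :=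
  G.map (contractMap A B)

end Network

/-! Under `φ ↦ √r φ`, finite-energy functions on directed edges become vectors of the Hilbert space
`EdgeSpace`, with squared norm twice the energy. A potential of finite energy is harmonic iff its
gradient is orthogonal to the gradients of all vertex indicators, which are finitely supported by
local finiteness.

Given a non-constant harmonic `h` of finite energy, choose levels `c < c'` strictly between two of
its values. The sets `h > c'` and `h < c` induce the transient subnetworks, and `h` clipped to `[c,
c']` is the potential on the contraction. Transience is `isTransient_induce_of_isHarmonic`:
otherwise `exists_small_of_not_isTransient` supplies finitely supported cut-offs of arbitrarily
small energy, and testing `h` against such a cut-off times a capped height of `h` forces this height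
to be constant along edges, against connectedness.

Conversely, combine normalised flows in `A` and `B` with a walk from `a` in `A` to `b` in `B` so
that all divergences cancel. The flow parts do not see `ρ`, which is constant on `A` and on `B`; the
walk sees `ρ(A) - ρ(B)`. Hence the gradient of `ρ` lies outside the closed span of the vertex
gradients, and its component orthogonal to that span is the gradient of a non-constant harmonic
function (`not_inOHD_of_inner_ne_zero`). -/

namespace Network

variable {α β : Type*} {G A : Graph α β} {r : β → ℝ}

open scoped InnerProductSpace

/-! ### Energy as a Hilbert space norm -/

/-- The Hilbert space of square summable functions on triples `(e, x, y)`. -/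
abbrev EdgeSpace (α β : Type*) := lp (fun _ : β × α × α => ℝ) 2

/-- Reversal of a directed edge. -/
def rev (d : β × α × α) : β × α × α := (d.1, d.2.2, d.2.1)

@[simp] lemma rev_rev (d : β × α × α) : rev (rev d) = d := rfl
@[simp] lemma rev_fst (d : β × α × α) : (rev d).1 = d.1 := rfl

lemma rev_mem_dirEdges {d : β × α × α} : rev d ∈ dirEdges G ↔ d ∈ dirEdges G := by
  simp only [dirEdges, rev, Set.mem_ofPred_eq]
  rw [G.isLink_comm, ne_comm]

lemma dirEdges_mono (h : A ≤ G) : dirEdges A ⊆ dirEdges G := fun _ hd => ⟨hd.1.mono h, hd.2⟩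

lemma dirEdges_pos (hr : ∀ e ∈ E(G), 0 < r e) {d : β × α × α} (hd : d ∈ dirEdges G) :
    0 < r d.1 := hr _ hd.1.edge_mem

/-- The function `√r φ` on the directed edges of `G`, extended by zero. Its squared `ℓ²`-norm is
twice the energy of `φ`. -/
noncomputable def toVec (G : Graph α β) (r : β → ℝ) (φ : β × α × α → ℝ) : β × α × α → ℝ :=
  (dirEdges G).indicator fun d => √(r d.1) * φ d

lemma toVec_of_mem {φ : β × α × α → ℝ} {d : β × α × α} (hd : d ∈ dirEdges G) :
    toVec G r φ d = √(r d.1) * φ d := Set.indicator_of_mem hd _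

lemma toVec_of_notMem {φ : β × α × α → ℝ} {d : β × α × α} (hd : d ∉ dirEdges G) :
    toVec G r φ d = 0 := Set.indicator_of_notMem hd _

lemma toVec_induced_of_mem {f : α → ℝ} {d : β × α × α} (hd : d ∈ dirEdges G) :
    toVec G r (induced r f) d = (f d.2.1 - f d.2.2) / √(r d.1) := by
  rw [toVec_of_mem hd, induced, mul_div_left_comm, Real.sqrt_div_self, ← div_eq_mul_inv]

lemma toVec_induced_add (f g : α → ℝ) :
    toVec G r (induced r (f + g)) = toVec G r (induced r f) + toVec G r (induced r g) := by
  ext d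
  by_cases hd : d ∈ dirEdges G
  · simp only [toVec_induced_of_mem hd, Pi.add_apply]; ring
  · simp only [toVec_of_notMem hd, Pi.add_apply]; ring

lemma toVec_induced_smul (c : ℝ) (f : α → ℝ) :
    toVec G r (induced r (c • f)) = c • toVec G r (induced r f) := by
  ext d
  by_cases hd : d ∈ dirEdges G
  · simp only [toVec_induced_of_mem hd, Pi.smul_apply, smul_eq_mul]; ring
  · simp [toVec_of_notMem hd]

lemma memℓp_two_iff {ι : Type*} {f : ι → ℝ} :
    Memℓp f 2 ↔ Summable fun i => f i ^ 2 := by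
  rw [memℓp_gen_iff (by simp)]
  simp

lemma energy_lt_top_iff (hr : ∀ e ∈ E(G), 0 < r e) {φ : β × α × α → ℝ} :
    energy G r φ < ⊤ ↔ Memℓp (toVec G r φ) 2 := by
  have h1 : (fun d => toVec G r φ d ^ 2)
      = (dirEdges G).indicator fun d => r d.1 * φ d ^ 2 := by
    ext d
    by_cases hd : d ∈ dirEdges G
    · rw [toVec_of_mem hd, Set.indicator_of_mem hd, mul_pow,
        Real.sq_sqrt (dirEdges_pos hr hd).le]
    · rw [toVec_of_notMem hd, Set.indicator_of_notMem hd]; simp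
  rw [memℓp_two_iff, h1, ← summable_subtype_iff_indicator, energy, lt_top_iff_ne_top, Ne,
    ENNReal.div_eq_top]
  have h2 : ∀ d : dirEdges G, 0 ≤ r d.1.1 * φ d ^ 2 := fun d =>
    mul_nonneg (dirEdges_pos hr d.2).le (sq_nonneg _)
  have h3 : (∑' d : dirEdges G, ENNReal.ofReal (r d.1.1 * φ d ^ 2)) ≠ ⊤ ↔
      Summable fun d : dirEdges G => r d.1.1 * φ d ^ 2 := by
    refine ⟨fun h => ?_, fun h => ?_⟩
    · have := ENNReal.summable_toReal h
      exact this.congr fun d => ENNReal.toReal_ofReal (h2 d)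
    · rw [← ENNReal.ofReal_tsum_of_nonneg h2 h]
      exact ENNReal.ofReal_ne_top
  simpa [Function.comp_def] using h3

lemma potentialFiniteEnergy_iff (hr : ∀ e ∈ E(G), 0 < r e) {f : α → ℝ} :
    PotentialFiniteEnergy G r f ↔ Memℓp (toVec G r (induced r f)) 2 := energy_lt_top_iff hr

lemma IsLocallyFinite.mono (hG : IsLocallyFinite G) (h : A ≤ G) : IsLocallyFinite A :=
  fun v hv => (hG v (h.1 hv)).subset fun _ he => he.mono h

lemma IsLocallyFinite.finite_inEdges (hG : IsLocallyFinite G) (v : α) :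
    (inEdges G v).Finite := by
  by_cases hv : v ∈ V(G)
  · refine Set.Finite.of_finite_image (f := Prod.fst) ((hG v hv).subset ?_) ?_
    · rintro _ ⟨d, hd, rfl⟩
      have := hd.1.1.inc_right
      rwa [hd.2] at this
    · rintro ⟨e, x, y⟩ h1 ⟨e', x', y'⟩ h2 h
      obtain rfl : e = e' := h
      obtain rfl : y = v := h1.2
      obtain rfl : y' = y := h2.2
      obtain rfl := Graph.IsLink.left_unique h1.1.1 h2.1.1
      rfl
  · convert Set.finite_empty
    ext d
    simp only [inEdges, Set.mem_ofPred_eq, Set.mem_empty_iff_false, iff_false, not_and]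
    rintro hd rfl
    exact hv hd.1.right_mem

/-! ### Vertex gradients, accumulation and harmonicity -/

open Classical in
/-- The gradient of the indicator function of a vertex, and its inner product with an arbitrary
vector. -/
lemma exists_star (r : β → ℝ) {w : α} (hw : (inEdges G w).Finite) :
    ∃ b : EdgeSpace α β, ⇑b = toVec G r (induced r (Pi.single w 1)) ∧
      ∀ θ : EdgeSpace α β, ⟪θ, b⟫_ℝ = ∑ᶠ d ∈ inEdges G w, (θ (rev d) - θ d) / √(r d.1) := by
  -- The gradient is `1/√r` on edges leaving `w` and `-1/√r` on edges entering it; both are indexed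
  -- by the entering edges.
  refine ⟨∑ d ∈ hw.toFinset, (lp.single 2 (rev d) (1 / √(r d.1)) - lp.single 2 d (1 / √(r d.1))),
    ?_, fun θ => ?_⟩
  · ext d
    have hrev : ∀ x : β × α × α, d = rev x ↔ x = rev d :=
      fun x => ⟨fun h => by simp [h], fun h => by simp [h]⟩
    rw [lp.coeFn_sum, Finset.sum_apply]
    simp only [lp.coeFn_sub, Pi.sub_apply, lp.single_apply, Pi.single_apply, Finset.sum_sub_distrib, hrev]
    simp only [eq_comm (a := d), Finset.sum_ite_eq', Set.Finite.mem_toFinset]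
    have h1 : rev d ∈ inEdges G w ↔ d ∈ dirEdges G ∧ d.2.1 = w := by
      simp only [inEdges, Set.mem_ofPred_eq, rev_mem_dirEdges]; rfl
    have h2 : d ∈ inEdges G w ↔ d ∈ dirEdges G ∧ d.2.2 = w := Iff.rfl
    by_cases hd : d ∈ dirEdges G
    · rw [toVec_induced_of_mem hd]
      simp only [h1, h2, hd, true_and, Pi.single_apply, rev_fst]
      split_ifs <;> ring
    · rw [toVec_of_notMem hd]
      simp [h1, h2, hd]
  · rw [inner_sum, finsum_mem_eq_finite_toFinset_sum _ hw]
    refine Finset.sum_congr rfl fun d _ => ?_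
    rw [inner_sub_right, lp.inner_single_right, lp.inner_single_right]
    simp
    ring

lemma isAntisymm_induced (h : α → ℝ) : IsAntisymm G (induced r h) := by
  intro e x y _
  simp only [induced]
  ring

lemma accumulation_eq_zero_of_notMem {φ : β × α × α → ℝ} {v : α} (hv : v ∉ V(G)) :
    accumulation G φ v = 0 := by
  refine finsum_mem_eq_zero_of_forall_eq_zero fun d hd => ?_
  exact absurd (hd.2 ▸ hd.1.1.right_mem) hv

/-- The factor 2 counts both orientations of an edge; the sign arises because the gradient of an
indicator is negative on entering edges. Extension by zero lets flows of `A` be tested in `G`. -/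
lemma inner_star_toVec (hA : A ≤ G) (hr : ∀ e ∈ E(G), 0 < r e) {φ : β × α × α → ℝ}
    (hφ : IsAntisymm A φ) {θ : EdgeSpace α β} (hθ : ⇑θ = toVec A r φ) (w : α) :
    ∑ᶠ d ∈ inEdges G w, (θ (rev d) - θ d) / √(r d.1) = -2 * accumulation A φ w := by
  rw [accumulation, mul_finsum_mem, finsum_mem_def, finsum_mem_def]
  · refine finsum_congr fun d => ?_
    by_cases hd : d ∈ inEdges A w
    · have hdG : d ∈ inEdges G w := ⟨dirEdges_mono hA hd.1, hd.2⟩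
      rw [Set.indicator_of_mem hd, Set.indicator_of_mem hdG, hθ, toVec_of_mem hd.1,
        toVec_of_mem (rev_mem_dirEdges.2 hd.1), rev_fst]
      have h1 : φ (rev d) = - φ d := by
        have := hφ d.1 d.2.2 d.2.1 (rev_mem_dirEdges.2 hd.1)
        exact this
      have h2 : 0 < √(r d.1) := Real.sqrt_pos.2 (dirEdges_pos hr hdG.1)
      rw [h1]
      field_simp
      ring
    · rw [Set.indicator_of_notMem hd]
      by_cases hdG : d ∈ inEdges G w
      · have h3 : d ∉ dirEdges A := fun h => hd ⟨h, hdG.2⟩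
        rw [Set.indicator_of_mem hdG, hθ, toVec_of_notMem h3,
          toVec_of_notMem (fun h => h3 (rev_mem_dirEdges.1 h))]
        simp
      · rw [Set.indicator_of_notMem hdG]

lemma outEdges_eq_image (v : α) : outEdges G v = rev '' inEdges G v := by
  ext d
  constructor
  · intro hd
    exact ⟨rev d, ⟨rev_mem_dirEdges.2 hd.1, hd.2⟩, rfl⟩
  · rintro ⟨d, hd, rfl⟩
    exact ⟨rev_mem_dirEdges.2 hd.1, hd.2⟩

lemma finsum_mem_outEdges (F : β × α × α → ℝ) (v : α) :
    ∑ᶠ d ∈ outEdges G v, F d = ∑ᶠ d ∈ inEdges G v, F (rev d) := by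
  rw [outEdges_eq_image, finsum_mem_image]
  intro a _ b _ h
  rw [← rev_rev a, h, rev_rev]

/-- Clear the total conductance at `v`, which is positive as soon as `v` has a neighbour; otherwise
both sides are vacuous. -/
lemma isHarmonic_iff (hr : ∀ e ∈ E(G), 0 < r e) (hG : IsLocallyFinite G) {h : α → ℝ} :
    IsHarmonic G r h ↔ ∀ v ∈ V(G), accumulation G (induced r h) v = 0 := by
  refine forall₂_congr fun v _ => ?_
  have hfin := hG.finite_inEdges v
  rw [finsum_mem_outEdges, finsum_mem_outEdges, accumulation]
  have h1 : ∑ᶠ d ∈ inEdges G v, induced r h d =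
      ∑ᶠ d ∈ inEdges G v, h (rev d).2.2 * (1 / r (rev d).1) -
        h v * ∑ᶠ d ∈ inEdges G v, 1 / r (rev d).1 := by
    rw [mul_finsum_mem, ← finsum_mem_sub_distrib _ _ hfin]
    refine finsum_mem_congr rfl fun d hd => ?_
    rw [induced, hd.2]
    simp only [rev]
    ring
  rw [h1]
  by_cases hne : (outEdges G v).Nonempty
  · have hpos : 0 < ∑ᶠ d ∈ inEdges G v, 1 / r (rev d).1 := by
      rw [finsum_mem_eq_finite_toFinset_sum _ hfin]
      refine Finset.sum_pos (fun d hd => ?_) ?_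
      · exact one_div_pos.2 (dirEdges_pos (d := d) hr ((Set.Finite.mem_toFinset _).1 hd).1)
      · rw [outEdges_eq_image, Set.image_nonempty] at hne
        simpa using hne
    simp only [hne, forall_const]
    rw [inv_mul_eq_div, eq_div_iff hpos.ne', sub_eq_zero, eq_comm]
  · have h0 : inEdges G v = ∅ := by
      rw [outEdges_eq_image, Set.image_nonempty] at hne
      exact Set.not_nonempty_iff_eq_empty.1 hne
    simp [hne, h0]

/-! ### Finitely supported potentials: cut-offs and orthogonality -/

/-- In a network that is not transient, the indicator of a vertex can be cut off by finitely
supported potentials with arbitrarily small energy. -/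
lemma exists_small_of_not_isTransient (hr : ∀ e ∈ E(A), 0 < r e) (hA : IsLocallyFinite A)
    (hnt : ¬ IsTransient A r) {v : α} (hv : v ∈ V(A)) {ε : ℝ} (hε : 0 < ε) :
    ∃ (f : α → ℝ) (u : EdgeSpace α β), f.support.Finite ∧ f v = 1 ∧
      ⇑u = toVec A r (induced r f) ∧ ‖u‖ < ε := by
  classical
  choose b hb hbθ using fun w => exists_star r (hA.finite_inEdges w)
  set S := Submodule.span ℝ (b '' {w | w ≠ v}) with hS
  set K := S.topologicalClosure with hK
  have hKc : IsClosed (K : Set (EdgeSpace α β)) := S.isClosed_topologicalClosure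
  have : CompleteSpace K := hKc.completeSpace_coe
  -- Either the gradient at `v` is approximated by those at other vertices, and the difference is
  -- the cut-off, or its residual orthogonal to them yields a flow.
  by_cases hmem : b v ∈ K
  · obtain ⟨u, hu, hdist⟩ := Metric.mem_closure_iff.1 hmem ε hε
    have key : ∀ u ∈ S, ∃ g : α → ℝ, g.support.Finite ∧ g v = 0 ∧
        ⇑u = toVec A r (induced r g) := by
      intro u hu
      induction hu using Submodule.span_induction with
      | mem x hx =>
        obtain ⟨w, hw, rfl⟩ := hx
        refine ⟨Pi.single w 1, (Set.finite_singleton w).subset Pi.support_single_subset, ?_, hb w⟩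
        exact Pi.single_eq_of_ne (Ne.symm hw) _
      | zero =>
        refine ⟨0, by simp, rfl, ?_⟩
        rw [lp.coeFn_zero, ← zero_smul ℝ (0 : α → ℝ), toVec_induced_smul, zero_smul]
      | add x y _ _ hx hy =>
        obtain ⟨g, hg, hgv, hgu⟩ := hx
        obtain ⟨g', hg', hgv', hgu'⟩ := hy
        refine ⟨g + g', (hg.union hg').subset (Function.support_add _ _), by simp [hgv, hgv'], ?_⟩
        rw [lp.coeFn_add, hgu, hgu', toVec_induced_add]
      | smul c x _ hx =>
        obtain ⟨g, hg, hgv, hgu⟩ := hx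
        refine ⟨c • g, hg.subset (Function.support_const_smul_subset _ _), by simp [hgv], ?_⟩
        rw [lp.coeFn_smul, hgu, toVec_induced_smul]
    obtain ⟨g, hg, hgv, hgu⟩ := key u hu
    refine ⟨Pi.single v 1 + (-1 : ℝ) • g, b v + (-1 : ℝ) • u, ?_, by simp [hgv], ?_, ?_⟩
    · refine (((Set.finite_singleton v).subset Pi.support_single_subset).union
        (hg.subset (Function.support_const_smul_subset (-1 : ℝ) g))).subset
        (Function.support_add _ _)
    · rw [toVec_induced_add, toVec_induced_smul, lp.coeFn_add, lp.coeFn_smul, hgu, hb]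
    · rw [neg_one_smul, ← sub_eq_add_neg, ← dist_eq_norm]
      exact hdist
  · exfalso
    apply hnt
    set θ := b v - K.starProjection (b v) with hθ
    have hθK : θ ∈ Kᗮ := K.sub_starProjection_mem_orthogonal (b v)
    have hθ0 : θ ≠ 0 := fun h => hmem (by
      rw [sub_eq_zero.1 h]; exact K.starProjection_apply_mem _)
    have hort : ∀ w, w ≠ v → ⟪θ, b w⟫_ℝ = 0 := fun w hw =>
      (Submodule.mem_orthogonal' K θ).1 hθK _
        (S.le_topologicalClosure (Submodule.subset_span ⟨w, hw, rfl⟩))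
    have hθv : ⟪θ, b v⟫_ℝ ≠ 0 := by
      have h1 : ⟪θ, K.starProjection (b v)⟫_ℝ = 0 :=
        (Submodule.mem_orthogonal' K θ).1 hθK _ (K.starProjection_apply_mem _)
      have h2 : ⟪θ, b v⟫_ℝ = ⟪θ, θ⟫_ℝ := by
        conv_rhs => rw [hθ, inner_sub_right, ← hθ, h1, sub_zero]
      rw [h2]
      exact inner_self_ne_zero.2 hθ0
    -- The residual `θ` need not be antisymmetric. Antisymmetrising gives accumulation `⟪θ, b w⟫` at
    -- each `w`, hence intensity `‖θ‖² ≠ 0` at `v` and 0 elsewhere.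
    set φ : β × α × α → ℝ := fun d => (θ (rev d) - θ d) / √(r d.1) with hφ
    refine ⟨v, hv, ⟪θ, b v⟫_ℝ, hθv, φ, ⟨?_, ?_, ?_⟩, ?_⟩
    · intro e x y _
      simp only [hφ, rev]
      ring
    · rw [hbθ]; rfl
    · intro w _ hw
      rw [← hort w hw, hbθ]; rfl
    · rw [energy_lt_top_iff hr, memℓp_two_iff]
      have hs : Summable fun d => θ d ^ 2 := memℓp_two_iff.1 (lp.memℓp θ)
      have hs' : Summable fun d => θ (rev d) ^ 2 :=
        hs.comp_injective (i := rev) fun a b h => by rw [← rev_rev a, h, rev_rev]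
      refine Summable.of_nonneg_of_le (fun _ => sq_nonneg _) (fun d => ?_)
        ((hs.add hs').mul_left 2)
      by_cases hd : d ∈ dirEdges A
      · have h2 : 0 < √(r d.1) := Real.sqrt_pos.2 (dirEdges_pos hr hd)
        rw [toVec_of_mem hd, hφ, mul_div_cancel₀ _ h2.ne']
        nlinarith [sq_nonneg (θ (rev d) + θ d)]
      · rw [toVec_of_notMem hd, zero_pow two_ne_zero]
        positivity

lemma exists_toVec_orthogonal (hG : IsLocallyFinite G) {θ : EdgeSpace α β}
    (hθ : ∀ w, ∑ᶠ d ∈ inEdges G w, (θ (rev d) - θ d) / √(r d.1) = 0) (g : α →₀ ℝ) :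
    ∃ u : EdgeSpace α β, ⇑u = toVec G r (induced r g) ∧ ⟪θ, u⟫_ℝ = 0 := by
  classical
  induction g using Finsupp.induction_linear with
  | zero =>
    refine ⟨0, ?_, inner_zero_right _⟩
    rw [lp.coeFn_zero, Finsupp.coe_zero, ← zero_smul ℝ (0 : α → ℝ), toVec_induced_smul, zero_smul]
  | add f g hf hg =>
    obtain ⟨u, hu, hu0⟩ := hf
    obtain ⟨u', hu', hu0'⟩ := hg
    refine ⟨u + u', ?_, by rw [inner_add_right, hu0, hu0', add_zero]⟩
    rw [lp.coeFn_add, hu, hu', Finsupp.coe_add, toVec_induced_add]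
  | single w c =>
    obtain ⟨b, hb, hbθ⟩ := exists_star r (hG.finite_inEdges w)
    refine ⟨c • b, ?_, by rw [inner_smul_right, hbθ, hθ, mul_zero]⟩
    rw [lp.coeFn_smul, hb, ← toVec_induced_smul, Finsupp.single_eq_pi_single, ← Pi.single_smul]
    simp

lemma IsHarmonic.star_eq_zero (hr : ∀ e ∈ E(G), 0 < r e) (hG : IsLocallyFinite G) {h : α → ℝ}
    (hh : IsHarmonic G r h) {θ : EdgeSpace α β} (hθ : ⇑θ = toVec G r (induced r h)) (w : α) :
    ∑ᶠ d ∈ inEdges G w, (θ (rev d) - θ d) / √(r d.1) = 0 := by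
  rw [inner_star_toVec le_rfl hr (isAntisymm_induced h) hθ]
  by_cases hw : w ∈ V(G)
  · rw [(isHarmonic_iff hr hG).1 hh w hw, mul_zero]
  · rw [accumulation_eq_zero_of_notMem hw, mul_zero]

lemma hasSum_sq (θ : EdgeSpace α β) : HasSum (fun d => θ d ^ 2) (‖θ‖ ^ 2) := by
  have := lp.hasSum_inner (𝕜 := ℝ) θ θ
  rw [real_inner_self_eq_norm_sq] at this
  simpa using this

/-! ### Superlevel sets of harmonic functions are transient -/

/-- The height of `t` above the level `c`, capped at one. -/
noncomputable def cappedHeight (c t : ℝ) : ℝ := min (max (t - c) 0) 1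

lemma cappedHeight_nonneg (c t : ℝ) : 0 ≤ cappedHeight c t :=
  le_min (le_max_right _ _) zero_le_one

lemma cappedHeight_le_one (c t : ℝ) : cappedHeight c t ≤ 1 := min_le_right _ _

lemma cappedHeight_of_le {c t : ℝ} (h : t ≤ c) : cappedHeight c t = 0 := by
  rw [cappedHeight, max_eq_right (by linarith)]
  exact min_eq_left zero_le_one

lemma cappedHeight_pos {c t : ℝ} (h : c < t) : 0 < cappedHeight c t :=
  lt_min (lt_max_of_lt_left (by linarith)) zero_lt_one

lemma cappedHeight_mono (c : ℝ) : Monotone (cappedHeight c) := fun _ _ h =>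
  min_le_min_right _ (max_le_max_right _ (by linarith))

lemma cappedHeight_sub_le {c s t : ℝ} (h : s ≤ t) :
    cappedHeight c t - cappedHeight c s ≤ t - s := by
  unfold cappedHeight
  rcases max_cases (t - c) 0 with h1 | h1 <;> rcases max_cases (s - c) 0 with h2 | h2 <;>
    rcases min_cases (max (t - c) 0) 1 with h3 | h3 <;>
    rcases min_cases (max (s - c) 0) 1 with h4 | h4 <;> linarith

/-- The capped height is nondecreasing and 1-Lipschitz. -/
lemma sq_sub_cappedHeight_le (c s t : ℝ) :
    (cappedHeight c s - cappedHeight c t) ^ 2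
      ≤ (s - t) * (cappedHeight c s - cappedHeight c t) := by
  rcases le_total s t with h | h
  · nlinarith [cappedHeight_mono c h, cappedHeight_sub_le (c := c) h]
  · nlinarith [cappedHeight_mono c h, cappedHeight_sub_le (c := c) h]

/-- Discrete product rule: `|a|p - |b|q = (|a| + |b|)/2 · (p - q) + (|a| - |b|)(p + q)/2`. The last
term is the error, bounded using `p, q ≤ 1`. -/
lemma half_mul_le_mul_sub_add_abs {s t p q a b : ℝ} (hp : 0 ≤ p) (hp1 : p ≤ 1) (hq : 0 ≤ q)
    (hq1 : q ≤ 1) (h : 0 ≤ (s - t) * (p - q)) :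
    |a| * ((s - t) * (p - q)) / 2 ≤ (s - t) * (|a| * p - |b| * q) + |s - t| * |a - b| := by
  have h1 : |(s - t) * (|a| - |b|) * ((p + q) / 2)| ≤ |s - t| * |a - b| := by
    rw [abs_mul, abs_mul, abs_of_nonneg (by positivity : 0 ≤ (p + q) / 2)]
    have h2 := abs_abs_sub_abs_le_abs_sub a b
    have h3 : |s - t| * |(|a| - |b|)| ≤ |s - t| * |a - b| := by gcongr
    calc |s - t| * |(|a| - |b|)| * ((p + q) / 2) ≤ |s - t| * |(|a| - |b|)| * 1 := by
          gcongr; linarith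
      _ ≤ _ := by linarith
  have h4 := neg_le_of_abs_le h1
  have h5 : 0 ≤ |b| * ((s - t) * (p - q)) := by positivity
  nlinarith

/-- A superlevel set of a harmonic function of finite energy induces a transient network. -/
lemma isTransient_induce_of_isHarmonic (hr : ∀ e ∈ E(G), 0 < r e) (hconn : IsConnected G)
    (hG : IsLocallyFinite G) {h : α → ℝ} (hh : IsHarmonic G r h)
    (hfe : PotentialFiniteEnergy G r h) {c : ℝ} {x y : α} (hx : x ∈ V(G)) (hxc : c < h x)
    (hy : y ∈ V(G)) (hyc : h y ≤ c) :
    IsTransient (G.induce {z ∈ V(G) | c < h z}) r := by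
  set A := G.induce {z ∈ V(G) | c < h z} with hAdef
  have hAG : A ≤ G := Graph.induce_le fun _ hz => hz.1
  have hmemA : ∀ d ∈ dirEdges G, c < h d.2.1 → c < h d.2.2 → d ∈ dirEdges A := fun d hd h1 h2 =>
    ⟨⟨hd.1, ⟨hd.1.left_mem, h1⟩, ⟨hd.1.right_mem, h2⟩⟩, hd.2⟩
  by_contra hnt
  set w : α → ℝ := fun z => cappedHeight c (h z) with hw
  let η : EdgeSpace α β := ⟨_, (potentialFiniteEnergy_iff hr).1 hfe⟩
  have hη : ⇑η = toVec G r (induced r h) := rfl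
  have claim : ∀ d ∈ dirEdges G, c < h d.2.1 → w d.2.1 = w d.2.2 := by
    intro d₀ hd₀ hc
    set k := (h d₀.2.1 - h d₀.2.2) * (w d₀.2.1 - w d₀.2.2) / r d₀.1 with hk
    have hP : ∀ d : β × α × α, 0 ≤ (h d.2.1 - h d.2.2) * (w d.2.1 - w d.2.2) := fun d =>
      (sq_nonneg _).trans (sq_sub_cappedHeight_le c _ _)
    -- Pair the gradient of `h` with that of `|f| w`, where `f` is a cut-off equal to 1 at the
    -- initial vertex of `d₀`. The total is 0, all terms are nonnegative up to the error `|η| |u|`,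
    -- and the term at `d₀` controls `k / 2`.
    have hbound : ∀ δ > 0, k ≤ δ * (‖η‖ ^ 2 + 1) := by
      intro δ hδ
      obtain ⟨f, u, hfs, hf1, hu, hun⟩ := exists_small_of_not_isTransient
        (fun e he => hr e (Graph.IsSubgraph.edgeSet_mono hAG he)) (hG.mono hAG) hnt
        (v := d₀.2.1) ⟨hd₀.1.left_mem, hc⟩ hδ
      have hgs : (fun z => |f z| * w z).support.Finite := hfs.subset fun z hz => by
        rw [Function.mem_support] at hz ⊢
        exact fun h0 => hz (by simp [h0])
      obtain ⟨g, hg, hg0⟩ := exists_toVec_orthogonal hG (hh.star_eq_zero hr hG hη)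
        (Finsupp.ofSupportFinite _ hgs)
      rw [Finsupp.ofSupportFinite_coe] at hg
      have hT : HasSum (fun d => η d * g d) 0 := by
        have := lp.hasSum_inner (𝕜 := ℝ) η g
        rw [hg0] at this
        simpa [mul_comm] using this
      have hsum := hT.add ((((hasSum_sq η).mul_left δ).add
        ((hasSum_sq u).mul_left δ⁻¹)).div_const 2)
      have hterm : ∀ d ∈ dirEdges G, η d * g d + |η d| * |u d| ≥ 0 ∧
          (c < h d.2.1 → |f d.2.1| * ((h d.2.1 - h d.2.2) * (w d.2.1 - w d.2.2)) / 2 / r d.1 ≤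
            η d * g d + |η d| * |u d|) := by
        intro d hd
        have hrd := dirEdges_pos hr hd
        have hs : 0 < √(r d.1) := Real.sqrt_pos.2 hrd
        have hss : √(r d.1) * √(r d.1) = r d.1 := Real.mul_self_sqrt hrd.le
        have hPd := hP d
        have hTd : η d * g d =
            (h d.2.1 - h d.2.2) * (|f d.2.1| * w d.2.1 - |f d.2.2| * w d.2.2) / r d.1 := by
          rw [hη, hg, toVec_induced_of_mem hd, toVec_induced_of_mem hd, div_mul_div_comm, hss]
        by_cases hdA : d ∈ dirEdges A
        · have hUd : |η d| * |u d| =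
              |h d.2.1 - h d.2.2| * |f d.2.1 - f d.2.2| / r d.1 := by
            rw [hη, hu, toVec_induced_of_mem hd, toVec_induced_of_mem hdA, abs_div, abs_div,
              abs_of_pos hs, div_mul_div_comm, hss]
          have hmain := half_mul_le_mul_sub_add_abs (a := f d.2.1) (b := f d.2.2)
            (cappedHeight_nonneg c (h d.2.1)) (cappedHeight_le_one c (h d.2.1))
            (cappedHeight_nonneg c (h d.2.2)) (cappedHeight_le_one c (h d.2.2)) hPd
          rw [hTd, hUd, ← add_div]
          refine ⟨div_nonneg (le_trans (by positivity) hmain) hrd.le, fun _ => ?_⟩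
          exact div_le_div_of_nonneg_right hmain hrd.le
        -- Outside `A` the cut-off contributes no error, and at most one end of the edge lies above
        -- `c`. As `w` vanishes at the other end, the sign only needs `|f| ≥ 0`; hence the absolute
        -- value.
        · rw [hu, toVec_of_notMem hdA, abs_zero, mul_zero, add_zero, hTd]
          rcases le_or_gt (h d.2.1) c with h1 | h1
          · refine ⟨div_nonneg ?_ hrd.le, fun h2 => absurd h1 (not_le.2 h2)⟩
            have h0 : w d.2.1 = 0 := cappedHeight_of_le h1
            rw [h0] at hPd ⊢
            have : 0 ≤ |f d.2.2| * ((h d.2.1 - h d.2.2) * (0 - w d.2.2)) := by positivity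
            linarith
          · have h2 : h d.2.2 ≤ c := not_lt.1 fun h2 => hdA (hmemA d hd h1 h2)
            have h0 : w d.2.2 = 0 := cappedHeight_of_le h2
            rw [h0] at hPd ⊢
            have : 0 ≤ |f d.2.1| * ((h d.2.1 - h d.2.2) * (w d.2.1 - 0)) := by positivity
            refine ⟨div_nonneg (by linarith) hrd.le, fun _ => ?_⟩
            exact div_le_div_of_nonneg_right (by linarith) hrd.le
      -- The weight `δ` makes the summed error at most `δ (‖η‖² + 1) / 2`, because `‖u‖ < δ`.
      have hamgm : ∀ d, |η d| * |u d| ≤ (δ * η d ^ 2 + δ⁻¹ * u d ^ 2) / 2 := by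
        intro d
        have h1 : 0 ≤ δ⁻¹ * (δ * |η d| - |u d|) ^ 2 := by positivity
        have h2 : δ⁻¹ * (δ * |η d| - |u d|) ^ 2
            = δ * |η d| ^ 2 + δ⁻¹ * |u d| ^ 2 - 2 * (|η d| * |u d|) := by
          field_simp
          ring
        rw [h2, sq_abs, sq_abs] at h1
        linarith
      have hle := le_hasSum hsum d₀ fun d _ => by
        by_cases hd : d ∈ dirEdges G
        · linarith [(hterm d hd).1, hamgm d]
        · rw [hη, toVec_of_notMem hd, zero_mul]
          positivity
      have h3 := (hterm d₀ hd₀).2 hc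
      rw [hf1, abs_one, one_mul, div_right_comm, ← hk] at h3
      have h4 : δ⁻¹ * ‖u‖ ^ 2 ≤ δ := by
        rw [inv_mul_le_iff₀ hδ, ← sq]
        exact pow_le_pow_left₀ (norm_nonneg _) hun.le 2
      linarith [hamgm d₀]
    have hk0 : k ≤ 0 := by
      have hpos : 0 < ‖η‖ ^ 2 + 1 := by positivity
      refine le_of_forall_pos_le_add fun ε hε => ?_
      have := hbound (ε / (‖η‖ ^ 2 + 1)) (by positivity)
      rwa [div_mul_cancel₀ _ hpos.ne', ← zero_add ε] at this
    have hrd := dirEdges_pos hr hd₀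
    have h5 : (h d₀.2.1 - h d₀.2.2) * (w d₀.2.1 - w d₀.2.2) ≤ 0 := by
      by_contra hlt
      exact absurd hk0 (not_le.2 (div_pos (not_le.1 hlt) hrd))
    have h6 : (w d₀.2.1 - w d₀.2.2) ^ 2 ≤ 0 := (sq_sub_cappedHeight_le c _ _).trans h5
    exact sub_eq_zero.1 (pow_eq_zero_iff two_ne_zero |>.1 (le_antisymm h6 (sq_nonneg _)))
  have hadj : ∀ a b, G.Adj a b → w a = w b := by
    rintro a b ⟨e, he⟩
    by_cases hab : a = b
    · rw [hab]
    by_cases ha : c < h a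
    · exact claim (e, a, b) ⟨he, hab⟩ ha
    by_cases hb : c < h b
    · exact (claim (e, b, a) ⟨he.symm, Ne.symm hab⟩ hb).symm
    · rw [hw]
      simp only [cappedHeight_of_le (not_lt.1 ha), cappedHeight_of_le (not_lt.1 hb)]
  have hreach : ∀ z, Relation.ReflTransGen G.Adj x z → w x = w z := by
    intro z hz
    induction hz with
    | refl => rfl
    | tail _ hab ih => exact ih.trans (hadj _ _ hab)
  have h1 : 0 < w x := cappedHeight_pos hxc
  rw [hreach y (hconn.2 x hx y hy), show w y = 0 from cappedHeight_of_le hyc] at h1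
  exact lt_irrefl _ h1

/-! ### Contraction, and the pair of subnetworks from a harmonic function -/

lemma dirEdges_map {α' : Type*} (f : α → α') :
    dirEdges (G.map f) = (fun d => (d.1, f d.2.1, f d.2.2)) ''
      {d ∈ dirEdges G | f d.2.1 ≠ f d.2.2} := by
  ext ⟨e, x, y⟩
  constructor
  · rintro ⟨⟨a, b, hab, rfl, rfl⟩, hne⟩
    exact ⟨(e, a, b), ⟨⟨hab, fun h => hne (congrArg f h)⟩, hne⟩, rfl⟩
  · rintro ⟨⟨e, a, b⟩, ⟨hd, hne⟩, h⟩
    obtain ⟨rfl, rfl, rfl⟩ : e = _ ∧ _ = x ∧ _ = y := by simpa using h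
    exact ⟨⟨a, b, hd.1, rfl, rfl⟩, hne⟩

/-- The energy of a potential does not change when vertices on which it is constant are
identified. -/
lemma energy_map_induced {α' : Type*} (f : α → α') (ρ : α' → ℝ) :
    energy (G.map f) r (induced r ρ) = energy G r (induced r (ρ ∘ f)) := by
  unfold energy
  congr 1
  -- Opposite orientations of an edge have the same image only if the edge becomes a loop, and such
  -- edges are excluded.
  have hinj : Set.InjOn (fun d : β × α × α => (d.1, f d.2.1, f d.2.2))
      {d ∈ dirEdges G | f d.2.1 ≠ f d.2.2} := by
    rintro ⟨e, a, b⟩ ⟨hd, hne⟩ ⟨e', a', b'⟩ ⟨hd', _⟩ h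
    obtain ⟨rfl, h1, h2⟩ : e = e' ∧ f a = f a' ∧ f b = f b' := by simpa using h
    rcases hd.1.eq_and_eq_or_eq_and_eq hd'.1 with ⟨h3, h4⟩ | ⟨h3, h4⟩
    · simp only at h3 h4
      rw [h3, h4]
    · simp only at h3 h4 hne
      exact absurd (by rw [h1, h4]) hne
  rw [dirEdges_map, tsum_image (fun d : β × α' × α' =>
    ENNReal.ofReal (r d.1 * induced r ρ d ^ 2)) hinj]
  rw [tsum_subtype {d ∈ dirEdges G | f d.2.1 ≠ f d.2.2} fun d =>
      ENNReal.ofReal (r d.1 * induced r ρ (d.1, f d.2.1, f d.2.2) ^ 2),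
    tsum_subtype (dirEdges G) fun d => ENNReal.ofReal (r d.1 * induced r (ρ ∘ f) d ^ 2)]
  refine tsum_congr fun d => ?_
  by_cases hd : d ∈ dirEdges G
  · by_cases hne : f d.2.1 = f d.2.2
    · rw [Set.indicator_of_notMem (fun h => h.2 hne), Set.indicator_of_mem hd]
      simp [induced, hne]
    · rw [Set.indicator_of_mem (show d ∈ {d ∈ dirEdges G | f d.2.1 ≠ f d.2.2} from ⟨hd, hne⟩),
        Set.indicator_of_mem hd]
      rfl
  · rw [Set.indicator_of_notMem (fun h => hd h.1), Set.indicator_of_notMem hd]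

lemma potentialFiniteEnergy_contraction {A B : Graph α β} {ρ : ContractVertex α → ℝ} :
    PotentialFiniteEnergy (contraction G A B) r ρ ↔
      PotentialFiniteEnergy G r (ρ ∘ contractMap A B) := by
  rw [PotentialFiniteEnergy, PotentialFiniteEnergy, contraction, energy_map_induced]

lemma PotentialFiniteEnergy.of_abs_sub_le (hr : ∀ e ∈ E(G), 0 < r e) {f g : α → ℝ}
    (hf : PotentialFiniteEnergy G r f)
    (h : ∀ x ∈ V(G), ∀ y ∈ V(G), |g x - g y| ≤ |f x - f y|) : PotentialFiniteEnergy G r g := by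
  rw [potentialFiniteEnergy_iff hr, memℓp_two_iff] at hf ⊢
  refine Summable.of_nonneg_of_le (fun _ => sq_nonneg _) (fun d => ?_) hf
  by_cases hd : d ∈ dirEdges G
  · rw [toVec_induced_of_mem hd, toVec_induced_of_mem hd, div_pow, div_pow]
    exact div_le_div_of_nonneg_right
      (sq_le_sq.2 (h _ hd.1.left_mem _ hd.1.right_mem)) (sq_nonneg _)
  · rw [toVec_of_notMem hd, toVec_of_notMem hd]

lemma IsHarmonic.neg (hr : ∀ e ∈ E(G), 0 < r e) (hG : IsLocallyFinite G) {h : α → ℝ}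
    (hh : IsHarmonic G r h) : IsHarmonic G r (-h) := by
  rw [isHarmonic_iff hr hG] at hh ⊢
  intro v hv
  rw [← neg_eq_zero.2 (hh v hv), accumulation, accumulation, ← finsum_mem_neg_distrib]
  · refine finsum_mem_congr rfl fun d _ => ?_
    simp only [induced, Pi.neg_apply]
    ring
  · exact hG.finite_inEdges v

lemma exists_transient_pair (hr : ∀ e ∈ E(G), 0 < r e) (hconn : IsConnected G)
    (hG : IsLocallyFinite G) {h : α → ℝ} (hh : IsHarmonic G r h)
    (hfe : PotentialFiniteEnergy G r h) {x y : α} (hx : x ∈ V(G)) (hy : y ∈ V(G))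
    (hxy : h x < h y) :
    ∃ A B : Graph α β, A ≤ G ∧ B ≤ G ∧ Disjoint V(A) V(B) ∧ IsTransient A r ∧ IsTransient B r ∧
      ∃ ρ : ContractVertex α → ℝ, PotentialFiniteEnergy (contraction G A B) r ρ ∧
        ρ .vertexA ≠ ρ .vertexB := by
  obtain ⟨c, hxc, hcy⟩ := exists_between hxy
  obtain ⟨c', hcc', hc'y⟩ := exists_between hcy
  have hfe' : PotentialFiniteEnergy G r (-h) := hfe.of_abs_sub_le hr fun x _ y _ => by
    rw [Pi.neg_apply, Pi.neg_apply, neg_sub_neg, abs_sub_comm]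
  set A := G.induce {z ∈ V(G) | c' < h z} with hA
  set B := G.induce {z ∈ V(G) | -c < (-h) z} with hB
  have hdisj : ∀ z ∈ V(B), z ∉ V(A) := by
    intro z hzB hzA
    have h1 : c' < h z := hzA.2
    have h2 : -c < -h z := hzB.2
    linarith
  refine ⟨A, B, Graph.induce_le fun _ hz => hz.1, Graph.induce_le fun _ hz => hz.1,
    Set.disjoint_left.2 fun z hzA hzB => hdisj z hzB hzA,
    isTransient_induce_of_isHarmonic hr hconn hG hh hfe hy hc'y hx (by linarith),
    isTransient_induce_of_isHarmonic hr hconn hG (hh.neg hr hG) hfe' hx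
      (by simpa using hxc) hy (by simpa using hcy.le),
    fun z => ContractVertex.rec c' c (fun v => max c (min c' (h v))) z, ?_, hcc'.ne'⟩
  rw [potentialFiniteEnergy_contraction]
  refine hfe.of_abs_sub_le hr fun a ha b hb => ?_
  -- The clipped `h` equals `c'` on `A` and `c` on `B`, so it descends to the contraction; clipping
  -- does not increase differences.
  have hval : ∀ z ∈ V(G), ((fun z => ContractVertex.rec c' c (fun v => max c (min c' (h v))) z :
      ContractVertex α → ℝ) ∘ contractMap A B) z = max c (min c' (h z)) := by
    intro z hz
    rw [Function.comp_apply, contractMap]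
    split_ifs with h1 h2
    · have h3 : c' < h z := h1.2
      rw [min_eq_left h3.le, max_eq_right hcc'.le]
    · have h3 : -c < -h z := h2.2
      rw [max_eq_left ((min_le_right _ _).trans (by linarith))]
    · rfl
  rw [hval a ha, hval b hb]
  refine (abs_max_sub_max_le_max c _ c _).trans ?_
  rw [sub_self, abs_zero, max_eq_right (abs_nonneg _)]
  refine (abs_min_sub_min_le_max c' _ c' _).trans ?_
  rw [sub_self, abs_zero, max_eq_right (abs_nonneg _)]

/-! ### From transient subnetworks to a harmonic function -/

open Classical in
/-- Along a walk from `x` to `y`, the difference `f x - f y` is represented by a vector. -/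
lemma exists_walk_vector (hr : ∀ e ∈ E(G), 0 < r e) {x y : α}
    (h : Relation.ReflTransGen G.Adj x y) :
    ∃ p : EdgeSpace α β, ∀ (f : α → ℝ) (u : EdgeSpace α β), ⇑u = toVec G r (induced r f) →
      ⟪p, u⟫_ℝ = f x - f y := by
  induction h with
  | refl => exact ⟨0, fun f u _ => by rw [inner_zero_left, sub_self]⟩
  | @tail y z _ hyz ih =>
    obtain ⟨p, hp⟩ := ih
    obtain ⟨e, he⟩ := hyz
    by_cases hne : y = z
    · exact ⟨p, fun f u hu => by rw [hp f u hu, hne]⟩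
    · have hd : (e, y, z) ∈ dirEdges G := ⟨he, hne⟩
      -- The gradient has entry `(f y - f z) / √r` here, so weight `√r` on this single orientation
      -- recovers the difference.
      refine ⟨p + lp.single 2 (e, y, z) √(r e), fun f u hu => ?_⟩
      have hs : 0 < √(r e) := Real.sqrt_pos.2 (hr e he.edge_mem)
      rw [inner_add_left, hp f u hu, lp.inner_single_left, hu, toVec_induced_of_mem hd]
      simp only [RCLike.inner_apply, conj_trivial]
      field_simp
      ring

lemma closure_span_le_orthogonal {H : Type*} [NormedAddCommGroup H] [InnerProductSpace ℝ H]
    {ι : Type*} {b : ι → H} {t : H} (ht : ∀ i, ⟪t, b i⟫_ℝ = 0) :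
    (Submodule.span ℝ (Set.range b)).topologicalClosure ≤ (Submodule.span ℝ {t})ᗮ := by
  refine Submodule.topologicalClosure_minimal _ (Submodule.span_le.2 ?_)
    (Submodule.isClosed_orthogonal _)
  rintro _ ⟨i, rfl⟩
  exact Submodule.mem_orthogonal_singleton_iff_inner_right.2 (ht i)

open Classical in
/-- A gradient that is not orthogonal to a divergence-free vector has a harmonic part that is not
constant. -/
lemma not_inOHD_of_inner_ne_zero (hr : ∀ e ∈ E(G), 0 < r e) (hconn : IsConnected G)
    (hG : IsLocallyFinite G) {σ : α → ℝ} {u θ : EdgeSpace α β}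
    (hu : ⇑u = toVec G r (induced r σ))
    (hθ : ∀ (w : α) (b : EdgeSpace α β), ⇑b = toVec G r (induced r (Pi.single w 1)) →
      ⟪θ, b⟫_ℝ = 0)
    (hθu : ⟪θ, u⟫_ℝ ≠ 0) : ¬ InOHD G r := by
  intro hO
  obtain ⟨o, ho⟩ := hconn.1
  choose b hb hbstar using fun w => exists_star r (hG.finite_inEdges w)
  set K := (Submodule.span ℝ (Set.range b)).topologicalClosure with hK
  have hKc : IsClosed (K : Set (EdgeSpace α β)) := Submodule.isClosed_topologicalClosure _
  have : CompleteSpace K := hKc.completeSpace_coe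
  set q := u - K.starProjection u with hq
  have hqK : q ∈ Kᗮ := K.sub_starProjection_mem_orthogonal u
  have hq0 : q ≠ 0 := fun h => hθu (by
    rw [sub_eq_zero.1 h]
    exact Submodule.mem_orthogonal_singleton_iff_inner_right.1
      (closure_span_le_orthogonal (fun w => hθ w _ (hb w)) (K.starProjection_apply_mem u)))
  -- Since `q` is a limit of gradients, every linear relation satisfied by all gradients passes to
  -- `q`. This makes `q` itself a gradient, with potential recovered along walks to `o`.
  have hgrad : ∀ t : EdgeSpace α β, (∀ (f : α → ℝ) (v : EdgeSpace α β),
      ⇑v = toVec G r (induced r f) → ⟪t, v⟫_ℝ = 0) → ⟪t, q⟫_ℝ = 0 := by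
    intro t ht
    rw [hq, inner_sub_right, ht σ u hu, zero_sub, neg_eq_zero]
    exact Submodule.mem_orthogonal_singleton_iff_inner_right.1
      (closure_span_le_orthogonal (fun w => ht _ _ (hb w)) (K.starProjection_apply_mem u))
  have hp : ∀ z, ∃ p : EdgeSpace α β, z ∈ V(G) → ∀ (f : α → ℝ) (v : EdgeSpace α β),
      ⇑v = toVec G r (induced r f) → ⟪p, v⟫_ℝ = f z - f o := by
    intro z
    by_cases hz : z ∈ V(G)
    · obtain ⟨p, hp⟩ := exists_walk_vector hr (hconn.2 z hz o ho)
      exact ⟨p, fun _ => hp⟩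
    · exact ⟨0, fun h => absurd h hz⟩
  choose p hp using hp
  set h : α → ℝ := fun z => ⟪p z, q⟫_ℝ with hh
  have hqh : ⇑q = toVec G r (induced r h) := by
    ext d
    by_cases hd : d ∈ dirEdges G
    · have hs : 0 < √(r d.1) := Real.sqrt_pos.2 (dirEdges_pos hr hd)
      have h1 := hgrad (p d.2.1 - p d.2.2 - lp.single 2 d √(r d.1)) fun f v hv => by
        rw [inner_sub_left, inner_sub_left, hp _ hd.1.left_mem f v hv,
          hp _ hd.1.right_mem f v hv, lp.inner_single_left, hv, toVec_induced_of_mem hd]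
        simp only [RCLike.inner_apply, conj_trivial]
        field_simp
        ring
      rw [inner_sub_left, inner_sub_left, lp.inner_single_left] at h1
      simp only [RCLike.inner_apply, conj_trivial] at h1
      rw [toVec_induced_of_mem hd, eq_div_iff hs.ne']
      simp only [hh]
      linarith
    · have h1 := hgrad (lp.single 2 d 1) fun f v hv => by
        rw [lp.inner_single_left, hv, toVec_of_notMem hd, inner_zero_right]
      rw [lp.inner_single_left] at h1
      rw [toVec_of_notMem hd]
      simpa using h1
  have hharm : IsHarmonic G r h := by
    rw [isHarmonic_iff hr hG]
    intro v _
    have h1 := inner_star_toVec le_rfl hr (isAntisymm_induced h) hqh v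
    rw [← hbstar, (Submodule.mem_orthogonal' K q).1 hqK _
      (Submodule.le_topologicalClosure _ (Submodule.subset_span ⟨v, rfl⟩))] at h1
    linarith
  have hconst := hO h hharm ((potentialFiniteEnergy_iff hr).2 (hqh ▸ lp.memℓp q))
  apply hq0
  ext d
  rw [hqh]
  by_cases hd : d ∈ dirEdges G
  · rw [toVec_induced_of_mem hd, hconst _ hd.1.left_mem _ hd.1.right_mem, sub_self, zero_div]
    rfl
  · rw [toVec_of_notMem hd]
    rfl

open Classical in
/-- A transient subnetwork carries a vector whose divergence is concentrated in one vertex and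
which is orthogonal to the gradients of the potentials that are constant on the subnetwork. -/
lemma IsTransient.exists_vector (hr : ∀ e ∈ E(G), 0 < r e) (hG : IsLocallyFinite G) (hA : A ≤ G)
    (ht : IsTransient A r) :
    ∃ a ∈ V(A), ∃ θ : EdgeSpace α β,
      (∀ (w : α) (b : EdgeSpace α β), ⇑b = toVec G r (induced r (Pi.single w 1)) →
        ⟪θ, b⟫_ℝ = Pi.single (M := fun _ => ℝ) w 1 a) ∧
      ∀ (f : α → ℝ) (u : EdgeSpace α β), ⇑u = toVec G r (induced r f) →
        (∀ x ∈ V(A), ∀ y ∈ V(A), f x = f y) → ⟪θ, u⟫_ℝ = 0 := by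
  obtain ⟨a, ha, I, hI, φ, ⟨hφ, hφa, hφ0⟩, hφE⟩ := ht
  have hrA : ∀ e ∈ E(A), 0 < r e := fun e he => hr e (Graph.IsSubgraph.edgeSet_mono hA he)
  let θ : EdgeSpace α β := ⟨_, (energy_lt_top_iff hrA).1 hφE⟩
  have hθ : ⇑θ = toVec A r φ := rfl
  -- The scaling normalises the pairing with the vertex gradient at `a` to 1.
  refine ⟨a, ha, (-2 * I)⁻¹ • θ, fun w b hb => ?_, fun f u hu hf => ?_⟩
  · obtain ⟨b', hb', hstar⟩ := exists_star r (hG.finite_inEdges w)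
    obtain rfl : b = b' := lp.ext (hb.trans hb'.symm)
    rw [real_inner_smul_left, hstar, inner_star_toVec hA hr hφ hθ, Pi.single_apply]
    split_ifs with h
    · rw [← h, hφa]
      field_simp
    · have : accumulation A φ w = 0 := by
        by_cases hw : w ∈ V(A)
        · exact hφ0 w hw (Ne.symm h)
        · exact accumulation_eq_zero_of_notMem hw
      rw [this, mul_zero, mul_zero]
  · rw [real_inner_smul_left, lp.inner_eq_tsum]
    convert mul_zero _
    convert tsum_zero with d
    by_cases hd : d ∈ dirEdges A
    · rw [hu, toVec_induced_of_mem (dirEdges_mono hA hd), hf _ hd.1.left_mem _ hd.1.right_mem,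
        sub_self, zero_div, inner_zero_right]
    · rw [hθ, toVec_of_notMem hd, inner_zero_left]

end Network

theorem mainTheorem1 {α β : Type*} (G : Graph α β) (r : β → ℝ) (hr : ∀ e ∈ E(G), 0 < r e)
    (hconn : Network.IsConnected G) (hlf : Network.IsLocallyFinite G) :
    ¬ Network.InOHD G r ↔
      ∃ A B : Graph α β, A ≤ G ∧ B ≤ G ∧ Disjoint V(A) V(B) ∧
        Network.IsTransient A r ∧ Network.IsTransient B r ∧
        ∃ ρ : Network.ContractVertex α → ℝ,
          Network.PotentialFiniteEnergy (Network.contraction G A B) r ρ ∧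
          ρ .vertexA ≠ ρ .vertexB := by
  classical
  constructor
  · intro hO
    simp only [Network.InOHD, not_forall] at hO
    obtain ⟨h, hh, hfe, x, hx, y, hy, hxy⟩ := hO
    rcases lt_or_gt_of_ne hxy with hlt | hlt
    · exact Network.exists_transient_pair hr hconn hlf hh hfe hx hy hlt
    · exact Network.exists_transient_pair hr hconn hlf hh hfe hy hx hlt
  · rintro ⟨A, B, hA, hB, hdisj, htA, htB, ρ, hρ, hne⟩
    rw [Network.potentialFiniteEnergy_contraction] at hρ
    have hρA : ∀ z ∈ V(A), (ρ ∘ Network.contractMap A B) z = ρ .vertexA := fun z hz => by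
      rw [Function.comp_apply, Network.contractMap, if_pos hz]
    have hρB : ∀ z ∈ V(B), (ρ ∘ Network.contractMap A B) z = ρ .vertexB := fun z hz => by
      rw [Function.comp_apply, Network.contractMap, if_neg (Set.disjoint_right.1 hdisj hz),
        if_pos hz]
    let u : Network.EdgeSpace α β := ⟨_, (Network.potentialFiniteEnergy_iff hr).1 hρ⟩
    have hu : ⇑u = Network.toVec G r (Network.induced r (ρ ∘ Network.contractMap A B)) := rfl
    obtain ⟨a, ha, θA, hθA, hθAu⟩ := htA.exists_vector hr hlf hA
    obtain ⟨b, hb, θB, hθB, hθBu⟩ := htB.exists_vector hr hlf hB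
    obtain ⟨p, hp⟩ := Network.exists_walk_vector hr (hconn.2 a (hA.1 ha) b (hB.1 hb))
    -- On the indicator of `w`, `θA - θB` and `p` both evaluate to its value at `a` minus its value
    -- at `b`, so they cancel; on `ρ` only `p` survives.
    refine Network.not_inOHD_of_inner_ne_zero hr hconn hlf hu (θ := θA - θB - p)
      (fun w v hv => ?_) ?_
    · rw [inner_sub_left, inner_sub_left, hθA w v hv, hθB w v hv, hp _ v hv, sub_self]
    · rw [inner_sub_left, inner_sub_left, hp _ u hu,
        hθAu _ u hu (fun x hx y hy => by rw [hρA x hx, hρA y hy]),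
        hθBu _ u hu (fun x hx y hy => by rw [hρB x hx, hρB y hy]), hρA a ha, hρB b hb,
        sub_self, zero_sub, neg_ne_zero, sub_ne_zero]
      exact hne
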